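/- Conventions. All spaces are metric spaces, and $\mathbb{R}^2$ carries the Euclidean metric. For $h\ge 0$, an *$h$-short segment* $[x,y]_h$ is a path $\gamma:[0,L]\to X$ ($L\ge 0$) from $x$ to $y$ with $\operatorname{len}(\gamma)\ge d(x,y)\ge \operatorname{len}(\gamma)-h$. For a point $u=\gamma(t)$ on it, $[x,u]_h$ and $[u,y]_h$ denote the subpaths $\gamma|_{[0,t]}$ and $\gamma|_{[t,L]}$. $X$ is a *length space* if any two of its points are joined by an $h$-short segment for every $h>0$, and a *geodesic space* if any two of its points are joined by a $0$-short segment. An *$h$-short triangle* $T_h(x_1,x_2,x_3)$ consists of $h$-short segments $[x_1,x_2]_h,[x_2,x_3]_h,[x_3,x_1]_h$ (its sides). A *comparison triangle* is a Euclidean triangle with vertices $\bar x_1,\bar x_2,\bar x_3\in\mathbb{R}^2$ and $|\bar x_i-\bar x_j|=d(x_i,x_j)$. A point $\bar u\in[\bar x_i,\bar x_j]$ is a *comparison point* for $u\in[x_i,x_j]_h$ if $|\bar x_i-\bar u|\le\operatorname{len}([x_i,u]_h)$ and $|\bar u-\bar x_j|\le\operatorname{len}([u,x_j]_h)$. For $C>0$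 and $H:X\times X\times X\to(0,\infty)$, a length space $X$ is *$C$-rough CAT(0) with respect to $H$* if $d(u,v)\le|\bar u-\bar v|+C$ for all $x,y,z\in X$, all $h$-short triangles $T_h(x,y,z)$ with $h=H(x,y,z)$, all comparison triangles for it, all $u,v$ on different sides of $T_h(x,y,z)$ and all comparison points $\bar u,\bar v$ for $u,v$. It is *$C$-rough CAT(0) in the weak sense* if this holds for some $H$, and *$C$-rough CAT(0)* if this holds for $H(x,y,z)=1/\max\{1,d(x,y),d(x,z),d(y,z)\}$. A *CAT(0) space* is a geodesic space in which $d(u,v)\le|\bar u-\bar v|$ for all $u,v$ on different sides of a geodesic ($0$-short) triangle, with comparison points $\bar u,\bar v$ in a comparison triangle. $X$ is an *$n$-point limit* of a sequence $(X_m,d_m)_{m\in\mathbb{N}}$ of metric spaces if for all $x_1,\dots,x_n\in X$ and $\varepsilon>0$ there exist infinitely many $m$ and points $x_1(m),\dots,x_n(m)\in X_m$ such that $|d(x_i,x_j)-d_m(x_i(m),x_j(m))|<\varepsilon$ for $1\le i,j\le n$. **Theorem.** Suppose that the length space $(X,d)$ is a $5$-point limit of $(X_m,d_m)$, $m\in\mathbb{N}$,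 where each $(X_m,d_m)$ is $C_m$-rough CAT(0) in the weak sense for some constant $C_m>0$. If $C_m\le C$ for all $m\in\mathbb{N}$, then $(X,d)$ is $(3C+2\sqrt3)$-rough CAT(0). If $C_m\to 0$ and $(X,d)$ is complete, then $(X,d)$ is a CAT(0) space. -/

import Mathlib

open Set Filter Topology

/-- The restriction of `γ` to `[0, L]` is an `h`-short segment from `x` to `y`: a (continuous)
path whose length `len` satisfies `len ≥ d(x, y) ≥ len - h`. -/
def IsShortSegment {X : Type*} [MetricSpace X] (h : ℝ) (γ : ℝ → X) (L : ℝ) (x y : X) : Prop :=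
  0 ≤ L ∧ ContinuousOn γ (Icc 0 L) ∧ γ 0 = x ∧ γ L = y ∧
    edist x y ≤ eVariationOn γ (Icc 0 L) ∧
    eVariationOn γ (Icc 0 L) ≤ edist x y + ENNReal.ofReal h

/-- Length space: any two points are joined by an `h`-short segment, for every `h > 0`. -/
def IsLengthSpace (X : Type*) [MetricSpace X] : Prop :=
  ∀ x y : X, ∀ h : ℝ, 0 < h → ∃ (γ : ℝ → X) (L : ℝ), IsShortSegment h γ L x y

/-- Geodesic space: any two points are joined by a `0`-short segment. -/
def IsGeodesicSpace (X : Type*) [MetricSpace X] : Prop :=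
  ∀ x y : X, ∃ (γ : ℝ → X) (L : ℝ), IsShortSegment 0 γ L x y

/-- `h`-short triangle with vertices `p 0, p 1, p 2`; its `i`-th side is the `h`-short segment
`γ i` on `[0, L i]` from `p i` to `p (i + 1)`, with indices modulo `3`. -/
def IsShortTriangle {X : Type*} [MetricSpace X] (h : ℝ) (p : Fin 3 → X)
    (γ : Fin 3 → ℝ → X) (L : Fin 3 → ℝ) : Prop :=
  ∀ i, IsShortSegment h (γ i) (L i) (p i) (p (i + 1))

/-- `q 0, q 1, q 2` are the vertices of a Euclidean comparison triangle for `p 0, p 1, p 2`. -/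
def IsComparisonTriangle {X : Type*} [MetricSpace X] (p : Fin 3 → X)
    (q : Fin 3 → EuclideanSpace ℝ (Fin 2)) : Prop :=
  ∀ i j, dist (q i) (q j) = dist (p i) (p j)

/-- `w` is a comparison point on the Euclidean segment `[a, b]` for the point `γ t` of the path
`γ` on `[0, L]`: its distances to `a` and `b` are at most the lengths of the subpaths of `γ`
on `[0, t]` and `[t, L]`. -/
def IsComparisonPoint {X : Type*} [MetricSpace X] (γ : ℝ → X) (L t : ℝ)
    (a b w : EuclideanSpace ℝ (Fin 2)) : Prop :=
  w ∈ segment ℝ a b ∧ edist a w ≤ eVariationOn γ (Icc 0 t) ∧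
    edist w b ≤ eVariationOn γ (Icc t L)

/-- For all `h`-short triangles with vertices `p 0, p 1, p 2`, all comparison triangles, all
points `u`, `v` on different sides and all comparison points `u'`, `v'` for them,
`d(u, v) ≤ |u' - v'| + C`. -/
def RoughComparison {X : Type*} [MetricSpace X] (C h : ℝ) (p : Fin 3 → X) : Prop :=
  ∀ (γ : Fin 3 → ℝ → X) (L : Fin 3 → ℝ) (q : Fin 3 → EuclideanSpace ℝ (Fin 2)),
    IsShortTriangle h p γ L → IsComparisonTriangle p q →
    ∀ i j : Fin 3, i ≠ j → ∀ s ∈ Icc 0 (L i), ∀ t ∈ Icc 0 (L j),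
      ∀ u' v' : EuclideanSpace ℝ (Fin 2),
        IsComparisonPoint (γ i) (L i) s (q i) (q (i + 1)) u' →
        IsComparisonPoint (γ j) (L j) t (q j) (q (j + 1)) v' →
        dist (γ i s) (γ j t) ≤ dist u' v' + C

/-- CAT(0) space: a geodesic space in which geodesic triangles are no fatter than their
Euclidean comparison triangles. -/
def IsCAT0 (X : Type*) [MetricSpace X] : Prop :=
  IsGeodesicSpace X ∧ ∀ p : Fin 3 → X, RoughComparison 0 0 p

/-- `C`-rough CAT(0) with respect to a shortness function `H`. -/
def IsRoughCAT0With (X : Type*) [MetricSpace X] (C : ℝ) (H : X → X → X → ℝ) : Prop :=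
  0 < C ∧ (∀ x y z, 0 < H x y z) ∧ IsLengthSpace X ∧
    ∀ x y z : X, RoughComparison C (H x y z) ![x, y, z]

/-- The weaker variant of `C`-rough CAT(0), in which `H` is some arbitrary positive function. -/
def IsRoughCAT0Weak (X : Type*) [MetricSpace X] (C : ℝ) : Prop :=
  ∃ H : X → X → X → ℝ, IsRoughCAT0With X C H

/-- `C`-rough CAT(0): the shortness function is `1 / max (1, d(x,y), d(x,z), d(y,z))`. -/
def IsRoughCAT0 (X : Type*) [MetricSpace X] (C : ℝ) : Prop :=
  IsRoughCAT0With X C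
    (fun x y z => 1 / max 1 (max (dist x y) (max (dist x z) (dist y z))))

/-- `X` is an `n`-point limit of the sequence `Y`. -/
def IsPointLimit (n : ℕ) (X : Type*) [MetricSpace X]
    (Y : ℕ → Type*) [∀ m, MetricSpace (Y m)] : Prop :=
  ∀ (x : Fin n → X) (ε : ℝ), 0 < ε → ∃ᶠ m in atTop, ∃ y : Fin n → Y m,
    ∀ i j, |dist (x i) (x j) - dist (y i) (y j)| < ε

/-!
The proof rests on one inequality between the mutual distances of five points. Let `x, y, z, u, v`
be points of a `C`-rough CAT(0) space in the weak sense, and `τ, σ ∈ [0, 1]`. Choose points `u₀`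
and `v₀` dividing very short segments `[x, y]` and `[y, z]` in the ratios given by `τ` and `σ`.
Rough comparison in the triangle `x, y, z` bounds `d(u₀, v₀)`, and rough comparison in the triangles
`x, y, u` and `y, z, v`, where `u` and `v` are vertices, bounds `d(u₀, u)` and `d(v₀, v)`. By
Stewart's theorem the three Euclidean distances are square roots of polynomials in the distances of
the five points, so that `d(u, v) ≤ 3 C + √stewart + √crossSq + √stewart`
(`dist_le_of_isRoughCAT0Weak`). The shortness function no longer occurs, and both sides are
continuous in the distances: the inequality passes to 5-point limits (`dist_le_of_isPointLimit`).

In the limit space, let `u` and `v` lie on `h`-short sides with comparison points dividing the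
Euclidean sides in the ratios `τ` and `σ`. Then `crossSq` is the squared distance of the comparison
points, and the Stewart terms are at most `c h + h ^ 2`, with `c` the length of the Euclidean side
(`stewart_le`). For `h = 1 / max (1, ...)` this is at most `2`, so each square root is below `√3`.

If `C_m → 0`, then the inequality holds with `C = 0`. Applied to the triangle `x, y, x`, it shows
that points which almost divide the pair `x, y` in the ratio `τ` are almost unique, hence converge
by completeness, and that their limits form a geodesic. For `h = 0` the Stewart terms vanish, and
what is left is the CAT(0) inequality.
-/

/-! ### Stewart's theorem -/

/-- The squared distance, given by Stewart's theorem, from a vertex of a Euclidean triangle to the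
point dividing the opposite side in the ratio `τ : 1 - τ`; here `c` is the length of this side, and
`a` and `b` are the distances of the vertex from its two ends. -/
def stewart (τ a b c : ℝ) : ℝ := (1 - τ) * a ^ 2 + τ * b ^ 2 - τ * (1 - τ) * c ^ 2

/-- The squared distance between the point dividing the side `[x, y]` of a Euclidean triangle
`x, y, z` in the ratio `τ : 1 - τ` and the point dividing the side `[y, z]` in the ratio
`σ : 1 - σ`; here `a`, `b`, `c` are the lengths of `[x, y]`, `[y, z]`, `[x, z]`. -/
def crossSq (τ σ a b c : ℝ) : ℝ := (1 - τ) * stewart σ a c b + τ * (σ * b) ^ 2 - τ * (1 - τ) * a ^ 2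

theorem dist_lineMap_sq {E : Type*} [NormedAddCommGroup E] [InnerProductSpace ℝ E] (a b w : E)
    (τ : ℝ) : dist (AffineMap.lineMap a b τ) w ^ 2 = stewart τ (dist a w) (dist b w) (dist a b) := by
  have h1 : AffineMap.lineMap a b τ - w = (1 - τ) • (a - w) + τ • (b - w) := by
    rw [AffineMap.lineMap_apply_module]; module
  rw [dist_eq_norm, dist_eq_norm, dist_eq_norm, dist_eq_norm, h1, ← sub_sub_sub_cancel_right a b w,
    stewart]
  generalize a - w = p
  generalize b - w = r
  rw [norm_add_sq_real, norm_sub_sq_real, norm_smul, norm_smul, inner_smul_left, inner_smul_right,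
    mul_pow, mul_pow]
  simp only [Real.norm_eq_abs, sq_abs, conj_trivial]
  ring

theorem dist_lineMap_eq_sqrt {E : Type*} [NormedAddCommGroup E] [InnerProductSpace ℝ E]
    (a b w : E) (τ : ℝ) :
    dist (AffineMap.lineMap a b τ) w = √(stewart τ (dist a w) (dist b w) (dist a b)) := by
  rw [← dist_lineMap_sq, Real.sqrt_sq dist_nonneg]

theorem dist_lineMap_lineMap_eq_sqrt {E : Type*} [NormedAddCommGroup E] [InnerProductSpace ℝ E]
    (x y z : E) (τ σ : ℝ) :
    dist (AffineMap.lineMap x y τ) (AffineMap.lineMap y z σ) =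
      √(crossSq τ σ (dist x y) (dist y z) (dist x z)) := by
  rw [dist_lineMap_eq_sqrt]
  congr 1
  have h1 : dist x (AffineMap.lineMap y z σ) ^ 2 = stewart σ (dist x y) (dist x z) (dist y z) := by
    rw [dist_comm, dist_lineMap_sq, dist_comm y x, dist_comm z x]
  have h2 : dist y (AffineMap.lineMap y z σ) ^ 2 = (σ * dist y z) ^ 2 := by
    rw [dist_left_lineMap, mul_pow, mul_pow, Real.norm_eq_abs, sq_abs]
  rw [stewart, crossSq, h1, h2]

/-- If `a` and `b` bound the distances of a vertex from the ends of a Euclidean segment of length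
`c`, and likewise the distances of the point dividing this segment in the ratio `τ : 1 - τ`, and if
`a + b ≤ c + h`, then the vertex and the dividing point are close. -/
theorem stewart_le {τ a b c h d₁ d₂ : ℝ} (h0 : 0 ≤ τ) (h1 : τ ≤ 1) (hc : 0 ≤ c)
    (ha : τ * c ≤ a) (hb : (1 - τ) * c ≤ b) (hab : a + b ≤ c + h) (hd₁ : 0 ≤ d₁) (hd₂ : 0 ≤ d₂)
    (h₁ : d₁ ≤ a) (h₂ : d₂ ≤ b) : stewart τ d₁ d₂ c ≤ c * h + h ^ 2 := by
  obtain ⟨α, rfl⟩ : ∃ α, a = τ * c + α := ⟨a - τ * c, by ring⟩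
  obtain ⟨β, rfl⟩ : ∃ β, b = (1 - τ) * c + β := ⟨b - (1 - τ) * c, by ring⟩
  have hα : 0 ≤ α := by linarith
  have hβ : 0 ≤ β := by linarith
  have hαβ : α + β ≤ h := by linarith
  have hτ : 0 ≤ 1 - τ := by linarith
  have e1 : (1 - τ) * d₁ ^ 2 ≤ (1 - τ) * (τ * c + α) ^ 2 := by gcongr
  have e2 : τ * d₂ ^ 2 ≤ τ * ((1 - τ) * c + β) ^ 2 := by gcongr
  have e3 : α ^ 2 ≤ h ^ 2 := by gcongr; linarith
  have e4 : β ^ 2 ≤ h ^ 2 := by gcongr; linarith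
  have e5 : 2 * (τ * (1 - τ)) * (c * (α + β)) ≤ 1 * (c * h) := by
    have : 2 * (τ * (1 - τ)) ≤ 1 := by nlinarith [sq_nonneg (2 * τ - 1)]
    gcongr
  have e6 : (1 - τ) * α ^ 2 ≤ (1 - τ) * h ^ 2 := by gcongr
  have e7 : τ * β ^ 2 ≤ τ * h ^ 2 := by gcongr
  unfold stewart
  linarith

/-! ### Comparison triangles and short segments -/

theorem exists_isComparisonTriangle {X : Type*} [MetricSpace X] (x y z : X) :
    ∃ q : Fin 3 → EuclideanSpace ℝ (Fin 2), IsComparisonTriangle ![x, y, z] q := by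
  suffices h : ∃ a b c : EuclideanSpace ℝ (Fin 2),
      dist a b = dist x y ∧ dist b c = dist y z ∧ dist a c = dist x z by
    obtain ⟨a, b, c, h1, h2, h3⟩ := h
    refine ⟨![a, b, c], fun i j => ?_⟩
    fin_cases i <;> fin_cases j <;> simp [h1, h2, h3, dist_comm b a, dist_comm c a, dist_comm c b,
      dist_comm y x, dist_comm z x, dist_comm z y]
  rcases eq_or_ne x y with rfl | hne
  · refine ⟨0, 0, !₂[dist x z, 0], by simp, ?_, ?_⟩ <;>
      simp [EuclideanSpace.dist_eq, Fin.sum_univ_two]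
  have hc : 0 < dist x y := dist_pos.mpr hne
  set c := dist x y with hcdef
  set b := dist y z with hb
  set a := dist x z with ha
  have t1 : a ≤ c + b := dist_triangle x y z
  have t2 : b ≤ c + a := by
    rw [hb, hcdef, ha, dist_comm x y]; exact dist_triangle y x z
  have t3 : c ≤ a + b := by
    rw [hb, hcdef, ha, dist_comm y z]; exact dist_triangle x z y
  have ha0 : 0 ≤ a := dist_nonneg
  have hb0 : 0 ≤ b := dist_nonneg
  -- The foot of the altitude from the third vertex, by the law of cosines.
  obtain ⟨p, hp⟩ : ∃ p, 2 * c * p = c ^ 2 + a ^ 2 - b ^ 2 :=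
    ⟨(c ^ 2 + a ^ 2 - b ^ 2) / (2 * c), by field_simp⟩
  have hpa : p ^ 2 ≤ a ^ 2 := by
    have hu : p ≤ a := by
      have : 2 * c * p ≤ 2 * c * a := by
        nlinarith [mul_nonneg (sub_nonneg.2 t2) (sub_nonneg.2 t3),
          mul_nonneg (sub_nonneg.2 t1) (sub_nonneg.2 t3)]
      exact le_of_mul_le_mul_left this (by positivity)
    have hl : -a ≤ p := by
      have : 2 * c * (-a) ≤ 2 * c * p := by nlinarith
      exact le_of_mul_le_mul_left this (by positivity)
    exact sq_le_sq' hl hu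
  have hq : √(a ^ 2 - p ^ 2) ^ 2 = a ^ 2 - p ^ 2 := Real.sq_sqrt (by linarith)
  refine ⟨0, !₂[c, 0], !₂[p, √(a ^ 2 - p ^ 2)], ?_, ?_, ?_⟩
  · simp [EuclideanSpace.dist_eq, Fin.sum_univ_two, Real.sqrt_sq hc.le]
  · have : (c - p) ^ 2 + √(a ^ 2 - p ^ 2) ^ 2 = b ^ 2 := by rw [hq]; linarith
    simp [EuclideanSpace.dist_eq, Fin.sum_univ_two, Real.dist_eq, this, hb0]
  · simp [EuclideanSpace.dist_eq, Fin.sum_univ_two, hq, ha0]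

theorem IsShortSegment.mono {X : Type*} [MetricSpace X] {h h' : ℝ} {γ : ℝ → X} {L : ℝ} {x y : X}
    (hγ : IsShortSegment h γ L x y) (hh : h ≤ h') : IsShortSegment h' γ L x y := by
  obtain ⟨h1, h2, h3, h4, h5, h6⟩ := hγ
  exact ⟨h1, h2, h3, h4, h5, h6.trans (by gcongr)⟩

theorem IsShortSegment.edist_left_le {X : Type*} [MetricSpace X] {h : ℝ} {γ : ℝ → X} {L : ℝ}
    {x y : X} (hγ : IsShortSegment h γ L x y) {t : ℝ} (ht : t ∈ Icc 0 L) :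
    edist x (γ t) ≤ eVariationOn γ (Icc 0 t) := by
  rw [← hγ.2.2.1]
  exact eVariationOn.edist_le _ (left_mem_Icc.2 ht.1) (right_mem_Icc.2 ht.1)

theorem IsShortSegment.edist_right_le {X : Type*} [MetricSpace X] {h : ℝ} {γ : ℝ → X} {L : ℝ}
    {x y : X} (hγ : IsShortSegment h γ L x y) {t : ℝ} (ht : t ∈ Icc 0 L) :
    edist (γ t) y ≤ eVariationOn γ (Icc t L) := by
  rw [← hγ.2.2.2.1]
  exact eVariationOn.edist_le _ (left_mem_Icc.2 ht.2) (right_mem_Icc.2 ht.2)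

/-- The lengths of the two subpaths at a point of a short segment, as real numbers. -/
theorem IsShortSegment.exists_length {X : Type*} [MetricSpace X] {h : ℝ} {γ : ℝ → X} {L : ℝ}
    {x y : X} (hγ : IsShortSegment h γ L x y) (hh : 0 ≤ h) {t : ℝ} (ht : t ∈ Icc 0 L) :
    ∃ a b : ℝ, 0 ≤ a ∧ 0 ≤ b ∧ eVariationOn γ (Icc 0 t) = ENNReal.ofReal a ∧
      eVariationOn γ (Icc t L) = ENNReal.ofReal b ∧ dist x (γ t) ≤ a ∧ dist (γ t) y ≤ b ∧
      a + b ≤ dist x y + h := by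
  have hadd := eVariationOn.Icc_add_Icc γ (s := univ) ht.1 ht.2 (mem_univ t)
  simp only [univ_inter] at hadd
  have hle := hγ.2.2.2.2.2
  rw [← hadd, edist_dist, ← ENNReal.ofReal_add dist_nonneg hh] at hle
  have hfin := ne_top_of_le_ne_top ENNReal.ofReal_ne_top hle
  obtain ⟨f1, f2⟩ := ENNReal.add_ne_top.1 hfin
  have e1 := hγ.edist_left_le ht
  have e2 := hγ.edist_right_le ht
  rw [edist_dist] at e1 e2
  refine ⟨_, _, ENNReal.toReal_nonneg, ENNReal.toReal_nonneg, (ENNReal.ofReal_toReal f1).symm,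
    (ENNReal.ofReal_toReal f2).symm, (ENNReal.ofReal_le_iff_le_toReal f1).1 e1,
    (ENNReal.ofReal_le_iff_le_toReal f2).1 e2, ?_⟩
  rw [← ENNReal.toReal_add f1 f2]
  exact ENNReal.toReal_le_of_le_ofReal (by positivity) hle

theorem IsShortSegment.exists_dist_eq {X : Type*} [MetricSpace X] {h : ℝ} {γ : ℝ → X} {L : ℝ}
    {x y : X} (hγ : IsShortSegment h γ L x y) {τ : ℝ} (hτ : τ ∈ Icc (0 : ℝ) 1) :
    ∃ t ∈ Icc 0 L, dist x (γ t) = τ * dist x y := by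
  have hcont : ContinuousOn (fun t => dist x (γ t)) (Icc 0 L) :=
    (continuous_const.dist continuous_id).comp_continuousOn hγ.2.1
  have hivt := intermediate_value_Icc hγ.1 hcont
  simp only [hγ.2.2.1, hγ.2.2.2.1, dist_self] at hivt
  exact hivt ⟨mul_nonneg hτ.1 dist_nonneg, mul_le_of_le_one_left dist_nonneg hτ.2⟩

/-- A point of a short segment whose distance from the first end is `τ * dist x y` has the point
dividing a Euclidean comparison segment in the ratio `τ : 1 - τ` as a comparison point. -/
theorem IsShortSegment.isComparisonPoint {X : Type*} [MetricSpace X] {h : ℝ} {γ : ℝ → X} {L : ℝ}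
    {x y : X} (hγ : IsShortSegment h γ L x y) {τ t : ℝ} (hτ : τ ∈ Icc (0 : ℝ) 1)
    (ht : t ∈ Icc 0 L) (hd : dist x (γ t) = τ * dist x y) {a b : EuclideanSpace ℝ (Fin 2)}
    (hab : dist a b = dist x y) : IsComparisonPoint γ L t a b (AffineMap.lineMap a b τ) := by
  refine ⟨?_, le_trans ?_ (hγ.edist_left_le ht), le_trans ?_ (hγ.edist_right_le ht)⟩
  · rw [segment_eq_image_lineMap]; exact mem_image_of_mem _ hτ
  · rw [edist_dist, edist_dist, dist_left_lineMap, hd, Real.norm_of_nonneg hτ.1, hab]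
  · rw [edist_dist, edist_dist, dist_lineMap_right, Real.norm_of_nonneg (by linarith [hτ.2]), hab]
    have := dist_triangle x (γ t) y
    gcongr
    linarith

/-! ### The five-point inequality -/

/-- Rough comparison in the triangle `x, y, w` between the vertex `w` and a point of the side
`[x, y]`. -/
theorem dist_vertex_le {Y : Type*} [MetricSpace Y] {C h : ℝ} {x y w : Y} (hh : 0 < h)
    (hlen : IsLengthSpace Y) (hcmp : RoughComparison C h ![x, y, w]) {γ : ℝ → Y} {L : ℝ}
    (hγ : IsShortSegment h γ L x y) {τ t : ℝ} (hτ : τ ∈ Icc (0 : ℝ) 1) (ht : t ∈ Icc 0 L)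
    (hd : dist x (γ t) = τ * dist x y) :
    dist (γ t) w ≤ √(stewart τ (dist x w) (dist y w) (dist x y)) + C := by
  obtain ⟨γ₁, L₁, h₁⟩ := hlen y w h hh
  obtain ⟨γ₂, L₂, h₂⟩ := hlen w x h hh
  obtain ⟨q, hq⟩ := exists_isComparisonTriangle x y w
  have hT : IsShortTriangle h ![x, y, w] ![γ, γ₁, γ₂] ![L, L₁, L₂] := by
    intro i; fin_cases i <;> assumption
  have q01 : dist (q 0) (q 1) = dist x y := hq 0 1
  have q12 : dist (q 1) (q 2) = dist y w := hq 1 2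
  have q02 : dist (q 0) (q 2) = dist x w := hq 0 2
  have hw : IsComparisonPoint γ₁ L₁ L₁ (q 1) (q 2) (q 2) := by
    refine ⟨right_mem_segment _ _ _, ?_, by simp⟩
    have := h₁.2.2.2.2.1
    rwa [edist_dist, q12, ← edist_dist]
  have := hcmp _ _ q hT hq 0 1 (by decide) t ht L₁ (right_mem_Icc.2 h₁.1) _ _
    (hγ.isComparisonPoint hτ ht hd q01) hw
  change dist (γ t) (γ₁ L₁) ≤ dist (AffineMap.lineMap (q 0) (q 1) τ) (q 2) + C at this
  rwa [h₁.2.2.2.1, dist_lineMap_eq_sqrt, q01, q12, q02] at this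

theorem dist_le_of_isRoughCAT0Weak {Y : Type*} [MetricSpace Y] {C : ℝ} (hY : IsRoughCAT0Weak Y C)
    (x y z u v : Y) {τ σ : ℝ} (hτ : τ ∈ Icc (0 : ℝ) 1) (hσ : σ ∈ Icc (0 : ℝ) 1) :
    dist u v ≤ √(stewart τ (dist x u) (dist y u) (dist x y)) +
      √(crossSq τ σ (dist x y) (dist y z) (dist x z)) +
      √(stewart σ (dist y v) (dist z v) (dist y z)) + 3 * C := by
  obtain ⟨H, -, hH, hlen, hcmp⟩ := hY
  -- The sides `[x, y]` and `[y, z]` are to be short enough for both triangles they belong to.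
  obtain ⟨γ₀, L₀, h₀⟩ := hlen x y (min (H x y z) (H x y u)) (lt_min (hH _ _ _) (hH _ _ _))
  obtain ⟨γ₁, L₁, h₁⟩ := hlen y z (min (H x y z) (H y z v)) (lt_min (hH _ _ _) (hH _ _ _))
  obtain ⟨γ₂, L₂, h₂⟩ := hlen z x (H x y z) (hH _ _ _)
  obtain ⟨t, ht, htd⟩ := h₀.exists_dist_eq hτ
  obtain ⟨s, hs, hsd⟩ := h₁.exists_dist_eq hσ
  have hu := dist_vertex_le (hH _ _ _) hlen (hcmp x y u) (h₀.mono (min_le_right _ _)) hτ ht htd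
  have hv := dist_vertex_le (hH _ _ _) hlen (hcmp y z v) (h₁.mono (min_le_right _ _)) hσ hs hsd
  obtain ⟨q, hq⟩ := exists_isComparisonTriangle x y z
  have hT : IsShortTriangle (H x y z) ![x, y, z] ![γ₀, γ₁, γ₂] ![L₀, L₁, L₂] := by
    intro i
    fin_cases i
    exacts [h₀.mono (min_le_left _ _), h₁.mono (min_le_left _ _), h₂]
  have q01 : dist (q 0) (q 1) = dist x y := hq 0 1
  have q12 : dist (q 1) (q 2) = dist y z := hq 1 2
  have q02 : dist (q 0) (q 2) = dist x z := hq 0 2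
  have huv := hcmp x y z _ _ q hT hq 0 1 (by decide) t ht s hs _ _
    (h₀.isComparisonPoint hτ ht htd q01) (h₁.isComparisonPoint hσ hs hsd q12)
  change dist (γ₀ t) (γ₁ s) ≤ dist (AffineMap.lineMap (q 0) (q 1) τ)
    (AffineMap.lineMap (q 1) (q 2) σ) + C at huv
  rw [dist_lineMap_lineMap_eq_sqrt, q01, q12, q02] at huv
  have := dist_triangle4 u (γ₀ t) (γ₁ s) v
  rw [dist_comm u (γ₀ t)] at this
  linarith

theorem dist_le_of_isPointLimit {X : Type*} [MetricSpace X] {Y : ℕ → Type*}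
    [∀ m, MetricSpace (Y m)] {c : ℕ → ℝ} (hY : ∀ m, IsRoughCAT0Weak (Y m) (c m))
    (hlim : IsPointLimit 5 X Y) {C : ℝ} (hC : ∀ᶠ m in atTop, c m ≤ C) (x y z u v : X)
    {τ σ : ℝ} (hτ : τ ∈ Icc (0 : ℝ) 1) (hσ : σ ∈ Icc (0 : ℝ) 1) :
    dist u v ≤ √(stewart τ (dist x u) (dist y u) (dist x y)) +
      √(crossSq τ σ (dist x y) (dist y z) (dist x z)) +
      √(stewart σ (dist y v) (dist z v) (dist y z)) + 3 * C := by
  -- The inequality defines a closed set of `5 × 5` distance matrices.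
  let S : Set (Fin 5 → Fin 5 → ℝ) := {D | D 3 4 ≤ √(stewart τ (D 0 3) (D 1 3) (D 0 1)) +
      √(crossSq τ σ (D 0 1) (D 1 2) (D 0 2)) + √(stewart σ (D 1 4) (D 2 4) (D 1 2)) + 3 * C}
  have hS : IsClosed S := by
    unfold S stewart crossSq stewart
    exact isClosed_le (by fun_prop) (by fun_prop)
  let p : Fin 5 → X := ![x, y, z, u, v]
  have hmem : (fun i j => dist (p i) (p j)) ∈ closure S := by
    rw [Metric.mem_closure_iff]
    intro ε hε
    obtain ⟨m, ⟨w, hw⟩, hm⟩ := ((hlim p ε hε).and_eventually hC).exists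
    refine ⟨fun i j => dist (w i) (w j), ?_, ?_⟩
    · have := dist_le_of_isRoughCAT0Weak (hY m) (w 0) (w 1) (w 2) (w 3) (w 4) hτ hσ
      change dist (w 3) (w 4) ≤ _
      linarith
    · rw [dist_pi_lt_iff hε]
      intro i
      rw [dist_pi_lt_iff hε]
      exact fun j => hw i j
  rw [hS.closure_eq] at hmem
  exact hmem

/-! ### Comparison in the limit space -/

/-- The five-point inequality, for all points of `X` and all division ratios. -/
def FivePointInequality (X : Type*) [MetricSpace X] (K : ℝ) : Prop :=
  ∀ (x y z u v : X), ∀ τ ∈ Icc (0 : ℝ) 1, ∀ σ ∈ Icc (0 : ℝ) 1,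
    dist u v ≤ √(stewart τ (dist x u) (dist y u) (dist x y)) +
      √(crossSq τ σ (dist x y) (dist y z) (dist x z)) +
      √(stewart σ (dist y v) (dist z v) (dist y z)) + K

/-- The division ratio of a comparison point of a point `γ t` on an `h`-short segment, and the
resulting bound on the Stewart term. -/
theorem IsShortSegment.exists_ratio {X : Type*} [MetricSpace X] {h : ℝ} {γ : ℝ → X} {L : ℝ}
    {x y : X} (hγ : IsShortSegment h γ L x y) (hh : 0 ≤ h) {t : ℝ} (ht : t ∈ Icc 0 L)
    {a b w : EuclideanSpace ℝ (Fin 2)} (hab : dist a b = dist x y)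
    (hw : IsComparisonPoint γ L t a b w) :
    ∃ τ ∈ Icc (0 : ℝ) 1, w = AffineMap.lineMap a b τ ∧
      stewart τ (dist x (γ t)) (dist y (γ t)) (dist x y) ≤ dist x y * h + h ^ 2 := by
  obtain ⟨hseg, hl, hr⟩ := hw
  rw [segment_eq_image_lineMap] at hseg
  obtain ⟨τ, hτ, rfl⟩ := hseg
  obtain ⟨ℓ₁, ℓ₂, p₁, p₂, e₁, e₂, d₁, d₂, hsum⟩ := hγ.exists_length hh ht
  rw [e₁, edist_dist, dist_left_lineMap, Real.norm_of_nonneg hτ.1, hab,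
    ENNReal.ofReal_le_ofReal_iff p₁] at hl
  rw [e₂, edist_dist, dist_lineMap_right, Real.norm_of_nonneg (by linarith [hτ.2]), hab,
    ENNReal.ofReal_le_ofReal_iff p₂] at hr
  exact ⟨τ, hτ, rfl, stewart_le hτ.1 hτ.2 dist_nonneg hl hr hsum dist_nonneg dist_nonneg d₁
    (by rwa [dist_comm])⟩

theorem FivePointInequality.roughComparison {X : Type*} [MetricSpace X] {K h B : ℝ}
    (hX : FivePointInequality X K) {p : Fin 3 → X} (hh : 0 ≤ h)
    (hB : ∀ i, dist (p i) (p (i + 1)) * h + h ^ 2 ≤ B) :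
    RoughComparison (2 * √B + K) h p := by
  intro γ L q hγ hq
  have key : ∀ i, ∀ s ∈ Icc 0 (L i), ∀ t ∈ Icc 0 (L (i + 1)),
      ∀ u' v' : EuclideanSpace ℝ (Fin 2),
        IsComparisonPoint (γ i) (L i) s (q i) (q (i + 1)) u' →
        IsComparisonPoint (γ (i + 1)) (L (i + 1)) t (q (i + 1)) (q (i + 1 + 1)) v' →
        dist (γ i s) (γ (i + 1) t) ≤ dist u' v' + (2 * √B + K) := by
    intro i s hs t ht u' v' hu hv
    obtain ⟨τ, hτ, rfl, h₁⟩ := (hγ i).exists_ratio hh hs (hq _ _) hu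
    obtain ⟨σ, hσ, rfl, h₂⟩ := (hγ (i + 1)).exists_ratio hh ht (hq _ _) hv
    rw [dist_lineMap_lineMap_eq_sqrt, hq, hq, hq]
    have := hX (p i) (p (i + 1)) (p (i + 1 + 1)) (γ i s) (γ (i + 1) t) τ hτ σ hσ
    have := Real.sqrt_le_sqrt (h₁.trans (hB i))
    have := Real.sqrt_le_sqrt (h₂.trans (hB (i + 1)))
    linarith
  intro i j hij s hs t ht u' v' hu hv
  obtain rfl | rfl : j = i + 1 ∨ i = j + 1 := by
    clear hu hv hs ht
    decide +revert
  · exact key i s hs t ht u' v' hu hv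
  · rw [dist_comm, dist_comm u']
    exact key j t ht s hs v' u' hv hu

theorem isRoughCAT0_of_fivePointInequality {X : Type*} [MetricSpace X] {K : ℝ}
    (hlen : IsLengthSpace X) (hK : 0 ≤ K) (hX : FivePointInequality X K) :
    IsRoughCAT0 X (K + 2 * √3) := by
  refine ⟨by positivity, fun x y z => by positivity, hlen, fun x y z => ?_⟩
  set M := max 1 (max (dist x y) (max (dist x z) (dist y z))) with hM
  have hM1 : 1 ≤ M := le_max_left _ _
  have hM0 : 0 < M := by linarith
  have hxy : dist x y ≤ M := by simp [hM]
  have hxz : dist z x ≤ M := by simp [hM, dist_comm z x]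
  have hyz : dist y z ≤ M := by simp [hM]
  have bound : ∀ d ≤ M, d * (1 / M) + (1 / M) ^ 2 ≤ 3 := by
    intro d hd
    have h1 : d * (1 / M) ≤ 1 := by rw [mul_one_div, div_le_one hM0]; exact hd
    have h2 : 1 / M ≤ 1 := by rw [div_le_one hM0]; exact hM1
    have h3 : (1 / M) ^ 2 ≤ 1 := pow_le_one₀ (by positivity) h2
    linarith
  rw [add_comm]
  refine hX.roughComparison (by positivity) fun i => ?_
  fin_cases i
  exacts [bound _ hxy, bound _ hyz, bound _ hxz]

/-! ### Geodesics in complete spaces -/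

/-- For `z = x` the comparison triangle degenerates to a segment. -/
theorem sqrt_crossSq_degenerate (τ σ : ℝ) {a : ℝ} (ha : 0 ≤ a) :
    √(crossSq τ σ a a 0) = |1 - τ - σ| * a := by
  have : crossSq τ σ a a 0 = ((1 - τ - σ) * a) ^ 2 := by
    unfold crossSq stewart; ring
  rw [this, Real.sqrt_sq_eq_abs, abs_mul, abs_of_nonneg ha]

theorem FivePointInequality.exists_dividing_point {X : Type*} [MetricSpace X] [CompleteSpace X]
    (hlen : IsLengthSpace X) (hX : FivePointInequality X 0) (x y : X) {τ : ℝ}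
    (hτ : τ ∈ Icc (0 : ℝ) 1) :
    ∃ w, dist x w = τ * dist x y ∧ dist w y = (1 - τ) * dist x y := by
  have hstep : ∀ n : ℕ, ∃ w, dist x w = τ * dist x y ∧
      dist y w ≤ (1 - τ) * dist x y + 1 / ((n : ℝ) + 1) := by
    intro n
    have hn : (0 : ℝ) < 1 / ((n : ℝ) + 1) := by positivity
    obtain ⟨γ, L, hγ⟩ := hlen x y _ hn
    obtain ⟨t, ht, hd⟩ := hγ.exists_dist_eq hτ
    obtain ⟨a, b, -, -, -, -, h1, h2, h3⟩ := hγ.exists_length hn.le ht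
    refine ⟨γ t, hd, ?_⟩
    rw [dist_comm]
    linarith
  choose w hw₁ hw₂ using hstep
  have h1τ : 0 ≤ 1 - τ := by linarith [hτ.2]
  have h1σ : 1 - τ ∈ Icc (0 : ℝ) 1 := ⟨h1τ, by linarith [hτ.1]⟩
  let B : ℕ → ℝ := fun n => dist x y * (1 / ((n : ℝ) + 1)) + (1 / ((n : ℝ) + 1)) ^ 2
  have hst : ∀ N n, N ≤ n → stewart τ (dist x (w n)) (dist y (w n)) (dist x y) ≤ B N := by
    intro N n hn
    refine stewart_le (a := τ * dist x y) (b := (1 - τ) * dist x y + 1 / ((N : ℝ) + 1)) hτ.1 hτ.2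
      dist_nonneg le_rfl ?_ (by linarith) dist_nonneg dist_nonneg (hw₁ n).le ?_
    · have : (0 : ℝ) ≤ 1 / ((N : ℝ) + 1) := by positivity
      linarith
    · have := Nat.one_div_le_one_div (α := ℝ) hn
      linarith [hw₂ n]
  have hsymm : ∀ a b c : ℝ, stewart (1 - τ) a b c = stewart τ b a c := by
    intro a b c; unfold stewart; ring
  have hB : Tendsto (fun n => 2 * √(B n)) atTop (𝓝 0) := by
    have h1 := tendsto_one_div_add_atTop_nhds_zero_nat (𝕜 := ℝ)
    have h2 := (((h1.const_mul (dist x y)).add (h1.pow 2)).sqrt).const_mul 2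
    simpa [B] using h2
  have hcauchy : CauchySeq w := by
    refine cauchySeq_of_le_tendsto_0 _ (fun n m N hn hm => ?_) hB
    -- The dividing point of `[y, x]` in the ratio `1 - τ` is that of `[x, y]` in the ratio `τ`.
    have := hX x y x (w n) (w m) τ hτ (1 - τ) h1σ
    rw [hsymm, dist_self, dist_comm y x, sqrt_crossSq_degenerate _ _ dist_nonneg] at this
    have e1 := Real.sqrt_le_sqrt (hst N n hn)
    have e2 := Real.sqrt_le_sqrt (hst N m hm)
    simp only [sub_self, abs_zero, zero_mul, add_zero] at this
    linarith
  obtain ⟨w₀, hw₀⟩ := cauchySeq_tendsto_of_complete hcauchy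
  have l1 : dist x w₀ = τ * dist x y := by
    have := (tendsto_const_nhds (x := x)).dist hw₀
    simp only [hw₁] at this
    exact tendsto_nhds_unique this tendsto_const_nhds
  have l2 : dist y w₀ ≤ (1 - τ) * dist x y := by
    have h1 := (tendsto_one_div_add_atTop_nhds_zero_nat (𝕜 := ℝ)).const_add ((1 - τ) * dist x y)
    rw [add_zero] at h1
    exact le_of_tendsto_of_tendsto' ((tendsto_const_nhds (x := y)).dist hw₀) h1 hw₂
  refine ⟨w₀, l1, ?_⟩
  have := dist_triangle x w₀ y
  rw [dist_comm y] at l2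
  linarith

theorem FivePointInequality.isGeodesicSpace {X : Type*} [MetricSpace X] [CompleteSpace X]
    (hlen : IsLengthSpace X) (hX : FivePointInequality X 0) : IsGeodesicSpace X := by
  intro x y
  have hex : ∀ τ : ℝ, ∃ w, τ ∈ Icc (0 : ℝ) 1 →
      dist x w = τ * dist x y ∧ dist w y = (1 - τ) * dist x y := by
    intro τ
    by_cases hτ : τ ∈ Icc (0 : ℝ) 1
    · obtain ⟨w, hw⟩ := hX.exists_dividing_point hlen x y hτ
      exact ⟨w, fun _ => hw⟩
    · exact ⟨x, fun h => absurd h hτ⟩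
  choose γ hγ using hex
  have hlip : LipschitzOnWith (nndist x y) γ (Icc 0 1) := by
    refine LipschitzOnWith.of_dist_le_mul fun τ hτ σ hσ => ?_
    have h1σ : 1 - σ ∈ Icc (0 : ℝ) 1 := ⟨by linarith [hσ.2], by linarith [hσ.1]⟩
    have := hX x y x (γ τ) (γ σ) τ hτ (1 - σ) h1σ
    obtain ⟨a1, a2⟩ := hγ τ hτ
    obtain ⟨b1, b2⟩ := hγ σ hσ
    have z1 : stewart τ (τ * dist x y) ((1 - τ) * dist x y) (dist x y) = 0 := by
      unfold stewart; ring
    have z2 : stewart (1 - σ) ((1 - σ) * dist x y) (σ * dist x y) (dist x y) = 0 := by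
      unfold stewart; ring
    rw [dist_comm y (γ τ), dist_comm y (γ σ), dist_comm y x, a1, a2, b1, b2, z1, z2, dist_self,
      sqrt_crossSq_degenerate _ _ dist_nonneg] at this
    rw [coe_nndist, Real.dist_eq, abs_sub_comm τ σ, mul_comm]
    rw [show (1 : ℝ) - τ - (1 - σ) = σ - τ by ring] at this
    simpa using this
  obtain ⟨a1, -⟩ := hγ 0 (by simp)
  obtain ⟨-, b2⟩ := hγ 1 (by simp)
  have h0 : γ 0 = x := by
    rw [zero_mul, dist_eq_zero] at a1; exact a1.symm
  have h1 : γ 1 = y := by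
    rw [sub_self, zero_mul, dist_eq_zero] at b2; exact b2
  refine ⟨γ, 1, zero_le_one, hlip.continuousOn, h0, h1, ?_, ?_⟩
  · have := eVariationOn.edist_le γ (s := Icc (0 : ℝ) 1) (x := 0) (y := 1) (by simp) (by simp)
    rwa [h0, h1] at this
  · have hid : eVariationOn (id : ℝ → ℝ) (Icc 0 1) = 1 := by simp
    have := hlip.comp_eVariationOn_le (g := id) (s := Icc (0 : ℝ) 1) (mapsTo_id _)
    rw [Function.comp_id] at this
    refine this.trans ?_
    rw [ENNReal.ofReal_zero, add_zero, edist_nndist]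
    exact mul_le_of_le_one_right' hid.le

theorem isCAT0_of_fivePointInequality {X : Type*} [MetricSpace X] [CompleteSpace X]
    (hlen : IsLengthSpace X) (hX : FivePointInequality X 0) : IsCAT0 X := by
  refine ⟨hX.isGeodesicSpace hlen, fun p => ?_⟩
  have := hX.roughComparison (p := p) (h := 0) (B := 0) le_rfl (fun i => by simp)
  simpa using this

/-! ### Limits of rough CAT(0) spaces -/

theorem theoremT {X : Type*} [MetricSpace X] (Y : ℕ → Type*) [∀ m, MetricSpace (Y m)]
    (c : ℕ → ℝ) (hX : IsLengthSpace X) (hY : ∀ m, IsRoughCAT0Weak (Y m) (c m))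
    (hlim : IsPointLimit 5 X Y) :
    (∀ C : ℝ, (∀ m, c m ≤ C) → IsRoughCAT0 X (3 * C + 2 * Real.sqrt 3)) ∧
    (Tendsto c atTop (𝓝 0) → CompleteSpace X → IsCAT0 X) := by
  refine ⟨fun C hC => ?_, fun hc _ => ?_⟩
  · have hC0 : 0 ≤ C := by
      obtain ⟨H, hpos, -⟩ := hY 0
      exact hpos.le.trans (hC 0)
    exact isRoughCAT0_of_fivePointInequality hX (by positivity) fun x y z u v τ hτ σ hσ =>
      dist_le_of_isPointLimit hY hlim (Eventually.of_forall hC) x y z u v hτ hσ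
  · refine isCAT0_of_fivePointInequality hX fun x y z u v τ hτ σ hσ => ?_
    refine le_of_forall_pos_le_add fun δ hδ => ?_
    have hev : ∀ᶠ m in atTop, c m ≤ δ / 3 := hc.eventually_le_const (by positivity)
    have := dist_le_of_isPointLimit hY hlim hev x y z u v hτ hσ
    linarith
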